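/- For $0<\rho\le 1$ and $\varphi\in\mathbb R$ let $$A(\rho,\varphi)=\begin{pmatrix}\cos\varphi & -\rho^{-1}\sin\varphi\\ \rho\sin\varphi & \cos\varphi\end{pmatrix}.$$ For lines (one-dimensional subspaces) $V,W\subseteq\mathbb R^d$ let $\angle(V,W)=\arccos\big(\max\{v^{\top}w : v\in V,\ w\in W,\ \|v\|=\|w\|=1\}\big)\in[0,\tfrac{\pi}{2}]$ (Euclidean norm). For an invertible real $d\times d$ matrix $A$ the first (upper outer) angular value is $$\hat\theta_1(A)=\sup_{V\subseteq\mathbb R^d,\ \dim V=1}\ \limsup_{n\to\infty}\frac1n\sum_{j=1}^{n}\angle(A^{j-1}V,A^{j}V),$$ and $\mathrm{skew}(A)=\frac{1}{2r(A)}\|A-A^{\top}\|$, where $\|\cdot\|$ is the spectral norm and $r(A)$ is the largest modulus of a complex eigenvalue of $A$. For $\lambda>0$ let $\Psi_\lambda:\mathbb R\to\mathbb R$ be given by $\Psi_\lambda(\theta)=\arctan(\lambda\tan\theta)$ for $|\theta|<\frac{\pi}{2}$, $\Psi_\lambda(\pm\frac{\pi}{2})=\pm\frac{\pi}{2}$,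 and $\Psi_\lambda(\theta+n\pi)=\Psi_\lambda(\theta)+n\pi$ for $|\theta|\le\frac{\pi}{2}$, $n\in\mathbb Z$. For $\theta\in[0,\pi]$ and $j\ge 1$ put $$\delta(\theta)=2\Psi_\rho(\theta)-2\Psi_\rho(\theta+\varphi)+\pi,\qquad g_j(\theta)=\min(\theta_j-\theta_{j-1},\ \theta_{j-1}+\pi-\theta_j),$$ where $\theta_j=\Psi_\rho\big(j\varphi+\Psi_{\rho^{-1}}(\theta)\big)$ for $j\ge 0$. **Theorem.** Let $0<\rho\le1$. If $0<\varphi\le\frac{\pi}{2}$, then: (i) If $\mathrm{skew}(A(\rho,\varphi))\le 1$, then $\hat\theta_1(A(\rho,\varphi))=\varphi$. (ii) If $\mathrm{skew}(A(\rho,\varphi))>1$ and $\frac{\varphi}{\pi}\notin\mathbb Q$, then $\delta$ is integrable over $\{\theta\in[0,\pi]:\delta(\theta)<0\}$ and $$\hat\theta_1(A(\rho,\varphi))=\varphi+\frac1\pi\int_{\{\theta\in[0,\pi]\,:\,\delta(\theta)<0\}}\delta(\theta)\,d\theta.$$ (iii) If $\mathrm{skew}(A(\rho,\varphi))>1$ and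 $\frac{\varphi}{\pi}=\frac1q$ for an integer $q\ge2$, then $\hat\theta_1(A(\rho,\varphi))=\varphi$. (iv) If $\mathrm{skew}(A(\rho,\varphi))>1$ and $\frac{\varphi}{\pi}=\frac pq$ for positive integers $p,q$ such that $q$ is not a multiple of $p$, then the following maximum exists and $$\hat\theta_1(A(\rho,\varphi))=\frac1q\max_{0\le\theta\le\pi/2}\ \sum_{j=1}^{q}g_j(\theta).$$ If $\frac{\pi}{2}<\varphi<\pi$, then $\hat\theta_1(A(\rho,\varphi))=\hat\theta_1(A(\rho,\pi-\varphi))$. -/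

import Mathlib

open Real MeasureTheory

noncomputable section

/-- The first principal angle of two subspaces of `ℝ^d`: the arccosine of the maximum of `vᵀ w` over
unit vectors `v ∈ V`, `w ∈ W`. For lines this is the only principal angle, hence also the largest
one, and so it is the angle between the two lines. -/
def lineAngle {d : ℕ} (V W : Submodule ℝ (EuclideanSpace ℝ (Fin d))) : ℝ :=
  arccos (sSup {c : ℝ | ∃ v ∈ V, ∃ w ∈ W, ‖v‖ = 1 ∧ ‖w‖ = 1 ∧ c = inner ℝ v w})

/-- The solution operator `Φ(n, 0) = A_{n-1} ⋯ A_0` of the linear difference equation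
`u_{n+1} = A_n u_n`. -/
def solutionOp {d : ℕ} (A : ℕ → Matrix (Fin d) (Fin d) ℝ) : ℕ → Matrix (Fin d) (Fin d) ℝ
  | 0 => 1
  | n + 1 => A n * solutionOp A n

/-- The image `M V` of a subspace `V` of `ℝ^d` under a matrix `M`. -/
def imageSubspace {d : ℕ} (M : Matrix (Fin d) (Fin d) ℝ)
    (V : Submodule ℝ (EuclideanSpace ℝ (Fin d))) : Submodule ℝ (EuclideanSpace ℝ (Fin d)) :=
  V.map (Matrix.toEuclideanLin M)

/-- `a_{1,n}(V) = ∑_{j=1}^n ∠(Φ(j-1,0) V, Φ(j,0) V)`, for one-dimensional `V`. -/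
def angleSum {d : ℕ} (A : ℕ → Matrix (Fin d) (Fin d) ℝ) (n : ℕ)
    (V : Submodule ℝ (EuclideanSpace ℝ (Fin d))) : ℝ :=
  ∑ j ∈ Finset.Icc 1 n,
    lineAngle (imageSubspace (solutionOp A (j - 1)) V) (imageSubspace (solutionOp A j) V)

/-- The first (upper) outer angular value of the invertible system `u_{n+1} = A_n u_n`: the supremum
over all lines `V` of `limsup_{n → ∞} (1/n) a_{1,n}(V)`. -/
def outerAngularValue {d : ℕ} (A : ℕ → Matrix (Fin d) (Fin d) ℝ) : ℝ :=
  ⨆ V : {V : Submodule ℝ (EuclideanSpace ℝ (Fin d)) // Module.finrank ℝ V = 1},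
    Filter.limsup (fun n : ℕ => (1 / (n : ℝ)) * angleSum A n V.1) Filter.atTop

/-- The first (upper) outer angular value of the autonomous system `u_{n+1} = A u_n`. -/
def autonomousAngularValue {d : ℕ} (A : Matrix (Fin d) (Fin d) ℝ) : ℝ :=
  outerAngularValue fun _ => A

/-- The largest modulus of the complex eigenvalues of a real matrix. -/
def maxEigenvalueModulus {d : ℕ} (A : Matrix (Fin d) (Fin d) ℝ) : ℝ :=
  sSup {r : ℝ | ∃ μ ∈ spectrum ℂ (A.map (algebraMap ℝ ℂ)), r = ‖μ‖}

/-- The skewness `‖A - Aᵀ‖ / (2 r(A))`, where `‖·‖` is the matrix norm induced by the Euclidean norm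
and `r(A)` is the largest modulus of an eigenvalue. -/
def skewness {d : ℕ} (A : Matrix (Fin d) (Fin d) ℝ) : ℝ :=
  1 / (2 * maxEigenvalueModulus A) * ‖Matrix.toEuclideanCLM (n := Fin d) (𝕜 := ℝ) (A - A.transpose)‖

/-- The normal form `A(ρ, φ)`. -/
def normalForm (ρ φ : ℝ) : Matrix (Fin 2) (Fin 2) ℝ :=
  !![cos φ, -ρ⁻¹ * sin φ; ρ * sin φ, cos φ]

/-- `Ψ_l` on the basic interval `|t| ≤ π/2`. -/
def psiBase (l t : ℝ) : ℝ :=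
  if |t| < π / 2 then arctan (l * tan t) else t

/-- `Ψ_l` on the real line: the extension of `psiBase l` from `[-π/2, π/2]` that satisfies
`Ψ_l (t + n π) = Ψ_l t + n π` for all integers `n`. -/
def psi (l t : ℝ) : ℝ :=
  psiBase l (t - round (t / π) * π) + round (t / π) * π

/-- `δ(t) = 2 Ψ_ρ(t) - 2 Ψ_ρ(t + φ) + π`. -/
def deltaFun (ρ φ t : ℝ) : ℝ :=
  2 * psi ρ t - 2 * psi ρ (t + φ) + π

/-- `θ_j = Ψ_ρ(j φ + Ψ_{1/ρ}(t))`. -/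
def thetaIter (ρ φ : ℝ) (j : ℕ) (t : ℝ) : ℝ :=
  psi ρ (j * φ + psi ρ⁻¹ t)

/-- `g_j(t) = min(θ_j - θ_{j-1}, θ_{j-1} + π - θ_j)`, for `j ≥ 1`. -/
def gFun (ρ φ : ℝ) (j : ℕ) (t : ℝ) : ℝ :=
  min (thetaIter ρ φ j t - thetaIter ρ φ (j - 1) t)
    (thetaIter ρ φ (j - 1) t + π - thetaIter ρ φ j t)

end

/-! The matrix A(ρ,φ) is diag(1,ρ) · (rotation by φ) · diag(1,ρ)⁻¹, so it sends the line through
(cos t, ρ sin t) to the line with parameter t + φ. That line has polar angle Ψ_ρ(t). With d(t) =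
Ψ_ρ(t+φ) - Ψ_ρ(t), which lies in (0,π) for 0 < φ < π, one step turns the line by min(d, π - d), the
continuous π-periodic function `stepAngle`. The angular value is therefore the supremum of Birkhoff
averages of `stepAngle` along the rotation t ↦ t + φ of ℝ/πℤ.

Since Ψ_ρ - id is bounded and π-periodic (`psi_eq`), the sums of d telescope and d has mean φ. If
skew ≤ 1, every d is at most π/2 and the value is φ. If φ/π is irrational, Weyl's theorem gives the
mean of `stepAngle` = d + min(δ, 0). If qφ = pπ, averages along an orbit converge to the mean of q
consecutive steps, and a maximum over starting phases remains; periodicity and reflection confine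
the phase to [0,π/2]. For φ = π/q that maximum is attained at phase π/2, where no step is obtuse. -/

open Filter Topology

/-! ### The angle map Ψ_l -/

/-- The `π`-periodic difference `Ψ_l t - t`. -/
noncomputable def psiOffset (l t : ℝ) : ℝ :=
  arctan ((l - 1) * (sin t * cos t) / (cos t ^ 2 + l * sin t ^ 2))

theorem cos_sq_add_mul_sin_sq_pos {l : ℝ} (hl : 0 < l) (t : ℝ) :
    0 < cos t ^ 2 + l * sin t ^ 2 := by
  rcases eq_or_ne (cos t) 0 with h | h
  · have := sin_sq_add_cos_sq t
    rw [h] at this ⊢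
    have : sin t ^ 2 = 1 := by linarith
    rw [this]; linarith
  · positivity

theorem continuous_psiOffset {l : ℝ} (hl : 0 < l) : Continuous (psiOffset l) := by
  unfold psiOffset
  refine continuous_arctan.comp (Continuous.div (by fun_prop) (by fun_prop) fun t => ?_)
  exact (cos_sq_add_mul_sin_sq_pos hl t).ne'

theorem psiOffset_periodic (l : ℝ) : Function.Periodic (psiOffset l) π := by
  intro t
  simp [psiOffset, sin_add_pi, cos_add_pi]

theorem psiOffset_neg (l t : ℝ) : psiOffset l (-t) = -psiOffset l t := by
  simp [psiOffset, ← arctan_neg, neg_div]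

theorem abs_psiOffset_le (l t : ℝ) : |psiOffset l t| ≤ π / 2 :=
  abs_le.2 ⟨(neg_pi_div_two_lt_arctan _).le, (arctan_lt_pi_div_two _).le⟩

/-- The polar form of `(cos t, l sin t)`, whose polar angle is `t + psiOffset l t`. -/
theorem exists_polar {l : ℝ} (hl : 0 < l) (t : ℝ) :
    ∃ r : ℝ, 0 < r ∧ cos t = r * cos (t + psiOffset l t) ∧
      l * sin t = r * sin (t + psiOffset l t) := by
  have hD := cos_sq_add_mul_sin_sq_pos hl t
  have hsc := sin_sq_add_cos_sq t
  rw [cos_add, sin_add, psiOffset, cos_arctan, sin_arctan]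
  set x := (l - 1) * (sin t * cos t) / (cos t ^ 2 + l * sin t ^ 2) with hx
  have hxD : x * (cos t ^ 2 + l * sin t ^ 2) = (l - 1) * (sin t * cos t) := by
    rw [hx]; field_simp
  have hs : 0 < √(1 + x ^ 2) := by positivity
  -- (cos t, sin t) and (cos t, l sin t) have scalar product D = cos² t + l sin² t and determinant
  -- xD, so x is the tangent of the angle between them and the second vector has length D√(1 + x²).
  refine ⟨(cos t ^ 2 + l * sin t ^ 2) * √(1 + x ^ 2), by positivity, ?_, ?_⟩
  · field_simp
    linear_combination sin t * hxD - cos t * hsc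
  · field_simp
    linear_combination -cos t * hxD - l * sin t * hsc

theorem psiBase_eq {l : ℝ} (hl : 0 < l) {t : ℝ} (ht : |t| ≤ π / 2) :
    psiBase l t = t + psiOffset l t := by
  unfold psiBase
  split_ifs with h
  · obtain ⟨h1, h2⟩ := abs_lt.1 h
    have hc : 0 < cos t := cos_pos_of_mem_Ioo ⟨h1, h2⟩
    obtain ⟨r, hr, hrc, hrs⟩ := exists_polar hl t
    obtain ⟨o1, o2⟩ := abs_le.1 (abs_psiOffset_le l t)
    have hc' : 0 < cos (t + psiOffset l t) := by
      rw [hrc] at hc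
      exact pos_of_mul_pos_right hc hr.le
    have ht' : l * tan t = tan (t + psiOffset l t) := by
      rw [tan_eq_sin_div_cos, tan_eq_sin_div_cos, ← mul_div_assoc, hrs, hrc]
      field_simp
    -- The offset is at most π/2 in modulus, so t + offset stays in (-π, π); there a positive cosine
    -- forces it into (-π/2, π/2).
    rw [ht', arctan_tan]
    · by_contra! hcon
      have := cos_nonpos_of_pi_div_two_le_of_le (x := -(t + psiOffset l t)) (by linarith)
        (by linarith)
      rw [cos_neg] at this
      linarith
    · by_contra! hcon
      have := cos_nonpos_of_pi_div_two_le_of_le (x := t + psiOffset l t) hcon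
        (by linarith)
      linarith
  · have habs : |t| = π / 2 := le_antisymm ht (not_lt.1 h)
    have hc : cos t = 0 := by rw [← cos_abs, habs, cos_pi_div_two]
    simp [psiOffset, hc]

theorem psi_eq {l : ℝ} (hl : 0 < l) (t : ℝ) : psi l t = t + psiOffset l t := by
  have hb : |t - round (t / π) * π| ≤ π / 2 := by
    have h := abs_sub_round (t / π)
    have h2 : t - round (t / π) * π = (t / π - round (t / π)) * π := by
      field_simp
    rw [h2, abs_mul, abs_of_pos pi_pos]
    nlinarith [pi_pos]
  rw [psi, psiBase_eq hl hb, (psiOffset_periodic l).sub_int_mul_eq]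
  ring

theorem continuous_psi {l : ℝ} (hl : 0 < l) : Continuous (psi l) := by
  rw [funext (psi_eq hl)]
  exact continuous_id.add (continuous_psiOffset hl)

theorem psi_add_pi {l : ℝ} (hl : 0 < l) (t : ℝ) : psi l (t + π) = psi l t + π := by
  rw [psi_eq hl, psi_eq hl, psiOffset_periodic l]; ring

theorem psi_neg {l : ℝ} (hl : 0 < l) (t : ℝ) : psi l (-t) = -psi l t := by
  rw [psi_eq hl, psi_eq hl, psiOffset_neg]; ring

theorem psi_zero {l : ℝ} (hl : 0 < l) : psi l 0 = 0 := by
  simp [psi_eq hl, psiOffset]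

theorem psi_pi_div_two {l : ℝ} (hl : 0 < l) : psi l (π / 2) = π / 2 := by
  simp [psi_eq hl, psiOffset]

theorem psi_polar {l : ℝ} (hl : 0 < l) (t : ℝ) :
    ∃ r : ℝ, 0 < r ∧ cos t = r * cos (psi l t) ∧ l * sin t = r * sin (psi l t) := by
  rw [psi_eq hl]; exact exists_polar hl t

/-- The determinant of (cos t, l sin t) and (cos(t+φ), l sin(t+φ)) is l sin φ; dividing by the two
polar radii keeps its sign. -/
theorem sin_psi_sub_pos {l : ℝ} (hl : 0 < l) {φ : ℝ} (h0 : 0 < φ) (h1 : φ < π) (t : ℝ) :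
    0 < sin (psi l (t + φ) - psi l t) := by
  obtain ⟨r, hr, hc, hs⟩ := psi_polar hl t
  obtain ⟨r', hr', hc', hs'⟩ := psi_polar hl (t + φ)
  have key : r * r' * sin (psi l (t + φ) - psi l t) = l * sin φ := by
    have h2 : φ = (t + φ) - t := by ring
    rw [sin_sub]
    conv_rhs => rw [h2, sin_sub]
    linear_combination -(r * cos (psi l t)) * hs' - l * sin (t + φ) * hc + cos (t + φ) * hs
      + r * sin (psi l t) * hc'
  have : 0 < l * sin φ := mul_pos hl (sin_pos_of_pos_of_lt_pi h0 h1)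
  rw [← key] at this
  exact pos_of_mul_pos_right this (by positivity)

/-- As the shift s runs from 0 to π, the difference moves continuously from 0 to π. Its sine does
not vanish in between, so by the intermediate value theorem it cannot leave (0,π). -/
theorem psi_sub_mem_Ioo {l : ℝ} (hl : 0 < l) {φ : ℝ} (h0 : 0 < φ) (h1 : φ < π) (t : ℝ) :
    psi l (t + φ) - psi l t ∈ Set.Ioo 0 π := by
  have hcont : Continuous fun s => psi l (t + s) - psi l t :=
    ((continuous_psi hl).comp (continuous_const.add continuous_id)).sub continuous_const
  constructor
  · by_contra! hcon
    obtain ⟨s, ⟨hs0, hs1⟩, hs⟩ := intermediate_value_Icc h1.le hcont.continuousOn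
      (show (0 : ℝ) ∈ Set.Icc _ _ from ⟨hcon, by simp only [psi_add_pi hl]; linarith [pi_pos]⟩)
    simp only at hs
    rcases hs1.eq_or_lt with rfl | hs1
    · rw [psi_add_pi hl] at hs; linarith [pi_pos]
    · have := sin_psi_sub_pos hl (h0.trans_le hs0) hs1 t
      rw [hs, sin_zero] at this
      exact this.false
  · by_contra! hcon
    obtain ⟨s, ⟨hs0, hs1⟩, hs⟩ := intermediate_value_Icc h0.le hcont.continuousOn
      (show π ∈ Set.Icc _ _ from ⟨by simp [pi_pos.le], hcon⟩)
    simp only at hs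
    rcases hs0.eq_or_lt with rfl | hs0
    · simp at hs; linarith [pi_pos]
    · have := sin_psi_sub_pos hl hs0 (hs1.trans_lt h1) t
      rw [hs, sin_pi] at this
      exact this.false

/-- Used with l = ρ⁻¹ to exchange the maximum over angles θ for one over phases t = Ψ_{1/ρ}(θ). -/
theorem psi_image_Icc {l : ℝ} (hl : 0 < l) :
    psi l '' Set.Icc 0 (π / 2) = Set.Icc 0 (π / 2) := by
  have hmono : ∀ {a b : ℝ}, a ≤ b → b < a + π → psi l a ≤ psi l b := by
    intro a b hab hb
    rcases hab.eq_or_lt with rfl | hab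
    · rfl
    · have := (psi_sub_mem_Ioo hl (sub_pos.2 hab) (by linarith) a).1
      rw [add_sub_cancel] at this
      linarith
  apply Set.Subset.antisymm
  · rintro _ ⟨t, ⟨h0, h1⟩, rfl⟩
    have a := hmono h0 (by linarith [pi_pos])
    have b := hmono h1 (by linarith [pi_pos])
    rw [psi_zero hl] at a
    rw [psi_pi_div_two hl] at b
    exact ⟨a, b⟩
  · have := intermediate_value_Icc (by positivity : (0:ℝ) ≤ π / 2)
      (continuous_psi hl).continuousOn
    rwa [psi_zero hl, psi_pi_div_two hl] at this

/-- `r r' cos (Ψ(t+φ) - Ψ t)` in terms of trigonometric functions of `t`. -/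
theorem cos_psi_sub_nonneg_iff {l : ℝ} (hl : 0 < l) (φ t : ℝ) :
    0 ≤ cos (psi l (t + φ) - psi l t) ↔
      0 ≤ (1 + l ^ 2) * cos φ + (1 - l ^ 2) * cos (2 * t + φ) := by
  obtain ⟨r, hr, hc, hs⟩ := psi_polar hl t
  obtain ⟨r', hr', hc', hs'⟩ := psi_polar hl (t + φ)
  have key : 2 * (r * r') * cos (psi l (t + φ) - psi l t) =
      (1 + l ^ 2) * cos φ + (1 - l ^ 2) * cos (2 * t + φ) := by
    have h2 : φ = (t + φ) - t := by ring
    have h3 : 2 * t + φ = (t + φ) + t := by ring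
    rw [h3, cos_add (t + φ) t, cos_sub]
    conv_rhs => rw [h2, cos_sub, ← h2]
    linear_combination -2 * (r * cos (psi l t)) * hc' - 2 * cos (t + φ) * hc
      - 2 * (r * sin (psi l t)) * hs' - 2 * l * sin (t + φ) * hs
  rw [← key, mul_nonneg_iff_of_pos_left (by positivity)]

/-! ### Averages along periodic and equidistributed orbits -/

theorem tendsto_average_of_bounded {f : ℕ → ℝ} {m C : ℝ}
    (h : ∀ n : ℕ, |∑ j ∈ Finset.range n, f j - n * m| ≤ C) :
    Tendsto (fun n : ℕ => (1 / (n : ℝ)) * ∑ j ∈ Finset.range n, f j) atTop (𝓝 m) := by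
  rw [tendsto_iff_norm_sub_tendsto_zero]
  refine squeeze_zero' (Eventually.of_forall fun _ => norm_nonneg _) ?_
    (tendsto_const_div_atTop_nhds_zero_nat C)
  filter_upwards [eventually_gt_atTop 0] with n hn
  have hn' : (0 : ℝ) < n := Nat.cast_pos.2 hn
  have e : 1 / (n : ℝ) * ∑ j ∈ Finset.range n, f j - m =
      (∑ j ∈ Finset.range n, f j - n * m) / n := by field_simp
  rw [e, norm_div, Real.norm_eq_abs, Real.norm_natCast]
  gcongr
  exact h n

/-- The deviation of the partial sums from n times the mean is itself q-periodic, hence bounded. -/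
theorem tendsto_average_of_periodic {f : ℕ → ℝ} {q : ℕ} (hq : 0 < q)
    (hf : Function.Periodic f q) :
    Tendsto (fun n : ℕ => (1 / (n : ℝ)) * ∑ j ∈ Finset.range n, f j) atTop
      (𝓝 ((1 / (q : ℝ)) * ∑ j ∈ Finset.range q, f j)) := by
  set m := (1 / (q : ℝ)) * ∑ j ∈ Finset.range q, f j with hm
  set b : ℕ → ℝ := fun n => ∑ j ∈ Finset.range n, f j - n * m with hb
  have hq' : (0 : ℝ) < q := Nat.cast_pos.2 hq
  have hper : Function.Periodic b q := by
    intro n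
    simp only [hb]
    have e : ∑ j ∈ Finset.range n, f (q + j) = ∑ j ∈ Finset.range n, f j :=
      Finset.sum_congr rfl fun j _ => by rw [add_comm, hf]
    rw [add_comm n q, Finset.sum_range_add, e, hm]
    push_cast
    field_simp
    ring
  refine tendsto_average_of_bounded (C := ∑ i ∈ Finset.range q, |b i|) fun n => ?_
  rw [show ∑ j ∈ Finset.range n, f j - n * m = b n from rfl, ← hper.map_mod_nat n]
  exact Finset.single_le_sum (f := fun i => |b i|) (fun _ _ => abs_nonneg _)
    (Finset.mem_range.2 (Nat.mod_lt n hq))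

section Equidistribution

variable {T : ℝ} [hT : Fact (0 < T)]

/-- Uniform boundedness of the averaging functionals, which lets convergence pass from trigonometric
polynomials to their uniform closure. -/
theorem norm_average_le (f : C(AddCircle T, ℂ)) (u : ℕ → AddCircle T) (n : ℕ) :
    ‖(1 / (n : ℂ)) * ∑ j ∈ Finset.range n, f (u j)‖ ≤ ‖f‖ := by
  rcases n.eq_zero_or_pos with rfl | hn
  · simp
  have hn' : (0 : ℝ) < n := Nat.cast_pos.2 hn
  rw [norm_mul, norm_div, norm_one, Complex.norm_natCast, one_div, inv_mul_le_iff₀ hn']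
  calc _ ≤ ∑ j ∈ Finset.range n, ‖f (u j)‖ := norm_sum_le _ _
    _ ≤ ∑ j ∈ Finset.range n, ‖f‖ := Finset.sum_le_sum fun _ _ => f.norm_coe_le_norm _
    _ = _ := by simp

theorem integral_fourier_of_ne_zero {k : ℤ} (hk : k ≠ 0) :
    ∫ x, fourier (T := T) k x ∂AddCircle.haarAddCircle = 0 := by
  have := fourierCoeff_eq_intervalIntegral (T := T) (fun x => fourier k x) 0 0
  have h2 := orthonormal_iff_ite.1 (orthonormal_fourier (T := T)) 0 k
  rw [if_neg hk.symm, ContinuousMap.inner_toLp] at h2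
  simpa using h2

/-- Weyl's equidistribution theorem for rotations of the circle. -/
theorem tendsto_average_rotation {a : AddCircle T} (ha : ∀ k : ℤ, k ≠ 0 → k • a ≠ 0)
    (x : AddCircle T) (f : C(AddCircle T, ℂ)) :
    Tendsto (fun n : ℕ => (1 / (n : ℂ)) * ∑ j ∈ Finset.range n, f (x + j • a)) atTop
      (𝓝 (∫ y, f y ∂AddCircle.haarAddCircle)) := by
  have hint : ∀ f : C(AddCircle T, ℂ), Integrable f AddCircle.haarAddCircle := fun f =>
    f.continuous.integrable_of_hasCompactSupport (HasCompactSupport.of_compactSpace _)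
  have hspan : ∀ g ∈ Submodule.span ℂ (Set.range (fourier (T := T))),
      Tendsto (fun n : ℕ => (1 / (n : ℂ)) * ∑ j ∈ Finset.range n, g (x + j • a)) atTop
      (𝓝 (∫ y, g y ∂AddCircle.haarAddCircle)) := by
    intro g hg
    induction hg using Submodule.span_induction with
    | mem g hg =>
      obtain ⟨k, rfl⟩ := hg
      rcases eq_or_ne k 0 with rfl | hk
      · simp only [fourier_zero, integral_const, Finset.sum_const, Finset.card_range]
        refine tendsto_const_nhds.congr' ?_
        filter_upwards [eventually_gt_atTop 0] with n hn
        have : (n : ℂ) ≠ 0 := Nat.cast_ne_zero.2 hn.ne'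
        simp [this]
      · rw [integral_fourier_of_ne_zero hk]
        set z : ℂ := fourier k a with hz
        -- The character has nontrivial ratio z along the orbit, so its sums are geometric and
        -- bounded by 2/‖z - 1‖.
        have hz1 : z ≠ 1 := by
          intro h
          apply ha k hk
          apply AddCircle.injective_toCircle hT.out.ne'
          rw [AddCircle.toCircle_zero]
          ext
          rw [← fourier_apply, ← hz, h]; simp
        have hzn : ‖z‖ = 1 := by rw [hz, fourier_apply]; exact Circle.norm_coe _
        have hterm : ∀ j : ℕ, (fourier k (x + j • a) : ℂ) = fourier k x * z ^ j := by
          intro j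
          induction j with
          | zero => simp
          | succ j ih =>
            rw [succ_nsmul, ← add_assoc, fourier_apply, smul_add, AddCircle.toCircle_add,
              Circle.coe_mul, ← fourier_apply, ← fourier_apply, ih, pow_succ, mul_assoc]
        have hsum : ∀ n : ℕ, ∑ j ∈ Finset.range n, (fourier k (x + j • a) : ℂ) =
            fourier k x * ((z ^ n - 1) / (z - 1)) := by
          intro n
          rw [← geom_sum_eq hz1, Finset.mul_sum]
          exact Finset.sum_congr rfl fun j _ => hterm j
        have hxn : ‖(fourier k x : ℂ)‖ = 1 := by
          rw [fourier_apply]; exact Circle.norm_coe _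
        rw [tendsto_zero_iff_norm_tendsto_zero]
        refine squeeze_zero (fun _ => norm_nonneg _) (fun n => ?_)
          (tendsto_const_div_atTop_nhds_zero_nat (2 / ‖z - 1‖))
        rw [hsum, norm_mul, norm_mul, hxn, one_mul, norm_div, norm_div, norm_one,
          Complex.norm_natCast, one_div, inv_mul_eq_div]
        gcongr
        calc ‖z ^ n - 1‖ ≤ ‖z ^ n‖ + ‖(1 : ℂ)‖ := norm_sub_le _ _
          _ = 2 := by rw [norm_pow, hzn]; norm_num
    | zero => simp
    | add f g _ _ hf hg =>
      simp only [ContinuousMap.add_apply, Finset.sum_add_distrib, mul_add]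
      rw [integral_add (hint f) (hint g)]
      exact hf.add hg
    | smul c f _ hf =>
      simp only [ContinuousMap.smul_apply, ← Finset.smul_sum, mul_smul_comm]
      rw [integral_smul]
      exact hf.const_smul c
  have hdense : f ∈ closure (Submodule.span ℂ (Set.range (fourier (T := T))) :
      Set C(AddCircle T, ℂ)) := by
    rw [← Submodule.topologicalClosure_coe, span_fourier_closure_eq_top]
    trivial
  rw [Metric.tendsto_atTop]
  intro ε hε
  obtain ⟨g, hg, hfg⟩ := Metric.mem_closure_iff.1 hdense (ε / 3) (by positivity)
  obtain ⟨N, hN⟩ := Metric.tendsto_atTop.1 (hspan g hg) (ε / 3) (by positivity)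
  refine ⟨N, fun n hn => ?_⟩
  rw [dist_eq_norm] at hfg
  have h1 := norm_average_le (f - g) (fun j => x + j • a) n
  have h2 := hN n hn
  have h3 : ‖∫ y, (f - g) y ∂AddCircle.haarAddCircle‖ ≤ ‖f - g‖ := by
    have := norm_integral_le_of_norm_le_const (μ := AddCircle.haarAddCircle (T := T))
      (Eventually.of_forall fun y => (f - g).norm_coe_le_norm y)
    simpa using this
  simp only [ContinuousMap.sub_apply, Finset.sum_sub_distrib, mul_sub] at h1 h3
  rw [integral_sub (hint f) (hint g)] at h3
  rw [dist_eq_norm] at h2 ⊢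
  -- Three-ε argument: A, C are the averages and B, D the integrals of f and of its approximation g.
  have e : ∀ A B C D : ℂ, A - B = (A - C) + (C - D) - (B - D) := by intros; ring
  rw [e _ _ ((1 / (n : ℂ)) * ∑ j ∈ Finset.range n, g (x + j • a))
    (∫ y, g y ∂AddCircle.haarAddCircle)]
  refine ((norm_sub_le _ _).trans (add_le_add_left (norm_add_le _ _) _)).trans_lt ?_
  linarith

end Equidistribution

/-- Weyl's theorem for a continuous periodic function on the real line. -/
theorem tendsto_average_of_irrational {T φ : ℝ} (hT : 0 < T) (hφ : Irrational (φ / T))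
    {f : ℝ → ℝ} (hf : Continuous f) (hper : Function.Periodic f T) (t : ℝ) :
    Tendsto (fun n : ℕ => (1 / (n : ℝ)) * ∑ j ∈ Finset.range n, f (t + j * φ)) atTop
      (𝓝 ((1 / T) * ∫ x in 0..T, f x)) := by
  have : Fact (0 < T) := ⟨hT⟩
  have hper' : Function.Periodic (fun x => (f x : ℂ)) T := fun x => by simp [hper x]
  let F : C(AddCircle T, ℂ) := ⟨hper'.lift, by
    refine continuous_coinduced_dom.2 ?_
    exact Complex.continuous_ofReal.comp hf⟩
  have hF : ∀ x : ℝ, F (x : AddCircle T) = f x := fun x => rfl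
  have ha : ∀ k : ℤ, k ≠ 0 → k • (φ : AddCircle T) ≠ 0 := by
    intro k hk h
    rw [← AddCircle.coe_zsmul, AddCircle.coe_eq_zero_iff] at h
    obtain ⟨n, hn⟩ := h
    refine hφ ⟨(n : ℚ) / k, ?_⟩
    have hk' : (k : ℝ) ≠ 0 := Int.cast_ne_zero.2 hk
    simp only [zsmul_eq_mul] at hn
    push_cast
    field_simp
    linarith
  have key := tendsto_average_rotation ha (t : AddCircle T) F
  have hI : ∫ y, F y ∂AddCircle.haarAddCircle = (((1 / T) * ∫ x in 0..T, f x : ℝ) : ℂ) := by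
    rw [AddCircle.integral_haarAddCircle, ← AddCircle.intervalIntegral_preimage T 0]
    simp only [hF, zero_add, intervalIntegral.integral_ofReal]
    rw [Complex.real_smul]
    push_cast
    ring
  rw [hI] at key
  refine (Complex.continuous_re.tendsto _).comp key |>.congr fun n => ?_
  have : ∀ j : ℕ, F ((t : AddCircle T) + j • (φ : AddCircle T)) = ((f (t + j * φ) : ℝ) : ℂ) := by
    intro j
    rw [← hF]
    congr 1
    push_cast [← nsmul_eq_mul]
    rfl
  simp only [Function.comp, this]
  rw [← Complex.ofReal_sum, ← Complex.ofReal_natCast, ← Complex.ofReal_one,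
    ← Complex.ofReal_div, ← Complex.ofReal_mul, Complex.ofReal_re]

/-! ### Lines in the plane and their orbits -/

/-- For unit vectors, the angle between the spanned lines is `arccos |⟪v, w⟫|`. -/
theorem lineAngle_span_singleton {d : ℕ} {v w : EuclideanSpace ℝ (Fin d)}
    (hv : ‖v‖ = 1) (hw : ‖w‖ = 1) :
    lineAngle (Submodule.span ℝ {v}) (Submodule.span ℝ {w}) = arccos |inner ℝ v w| := by
  unfold lineAngle
  congr 1
  refine IsGreatest.csSup_eq ⟨?_, ?_⟩
  · rcases abs_choice (inner ℝ v w) with h | h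
    · exact ⟨v, Submodule.mem_span_singleton_self v, w, Submodule.mem_span_singleton_self w,
        hv, hw, h⟩
    · refine ⟨-v, neg_mem (Submodule.mem_span_singleton_self v), w,
        Submodule.mem_span_singleton_self w, by rwa [norm_neg], hw, ?_⟩
      rw [h, inner_neg_left]
  · rintro _ ⟨_, hv', _, hw', hv1, hw1, rfl⟩
    obtain ⟨a, rfl⟩ := Submodule.mem_span_singleton.1 hv'
    obtain ⟨b, rfl⟩ := Submodule.mem_span_singleton.1 hw'
    rw [norm_smul, hv, mul_one, Real.norm_eq_abs] at hv1
    rw [norm_smul, hw, mul_one, Real.norm_eq_abs] at hw1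
    refine (le_abs_self _).trans_eq ?_
    rw [inner_smul_left, inner_smul_right, abs_mul, abs_mul, hw1]
    simp [hv1]

/-- The line in the plane through `(cos t, l sin t)`. -/
noncomputable def ellipseLine (l t : ℝ) : Submodule ℝ (EuclideanSpace ℝ (Fin 2)) :=
  Submodule.span ℝ {!₂[cos t, l * sin t]}

theorem ellipseLine_eq_span {l : ℝ} (hl : 0 < l) (t : ℝ) :
    ellipseLine l t = Submodule.span ℝ {!₂[cos (psi l t), sin (psi l t)]} := by
  obtain ⟨r, hr, hc, hs⟩ := psi_polar hl t
  have : (!₂[cos t, l * sin t] : EuclideanSpace ℝ (Fin 2)) =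
      r • !₂[cos (psi l t), sin (psi l t)] := by
    ext i; fin_cases i <;> simp [hc, hs]
  rw [ellipseLine, this, Submodule.span_singleton_smul_eq (IsUnit.mk0 r hr.ne')]

theorem lineAngle_ellipseLine {l : ℝ} (hl : 0 < l) (s t : ℝ) :
    lineAngle (ellipseLine l s) (ellipseLine l t) = arccos |cos (psi l t - psi l s)| := by
  have hn : ∀ a : ℝ, ‖(!₂[cos a, sin a] : EuclideanSpace ℝ (Fin 2))‖ = 1 := by
    intro a
    simp [EuclideanSpace.norm_eq]
  rw [ellipseLine_eq_span hl, ellipseLine_eq_span hl, lineAngle_span_singleton (hn _) (hn _)]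
  congr 2
  simp [PiLp.inner_apply, Fin.sum_univ_two, cos_sub]

/-- Conjugacy to the rotation by φ through diag(1,ρ), read off from the addition formulas. -/
theorem imageSubspace_ellipseLine {ρ : ℝ} (hρ : 0 < ρ) (φ t : ℝ) :
    imageSubspace (normalForm ρ φ) (ellipseLine ρ t) = ellipseLine ρ (t + φ) := by
  rw [imageSubspace, ellipseLine, ellipseLine, Submodule.map_span, Set.image_singleton]
  congr 2
  ext i
  fin_cases i
  · simp [normalForm, Matrix.toLpLin_apply, cos_add]
    field_simp
    ring
  · simp [normalForm, Matrix.toLpLin_apply, sin_add]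
    ring

theorem imageSubspace_solutionOp {ρ : ℝ} (hρ : 0 < ρ) (φ t : ℝ) (n : ℕ) :
    imageSubspace (solutionOp (fun _ => normalForm ρ φ) n) (ellipseLine ρ t) =
      ellipseLine ρ (t + n * φ) := by
  induction n with
  | zero => simp [solutionOp, imageSubspace]
  | succ n ih =>
    have : imageSubspace (solutionOp (fun _ => normalForm ρ φ) (n + 1)) (ellipseLine ρ t) =
        imageSubspace (normalForm ρ φ)
          (imageSubspace (solutionOp (fun _ => normalForm ρ φ) n) (ellipseLine ρ t)) := by
      rw [imageSubspace, imageSubspace, imageSubspace, ← Submodule.map_comp, solutionOp]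
      congr 1
      ext v : 1
      simp [Matrix.toLpLin_apply]
    rw [this, ih, imageSubspace_ellipseLine hρ]
    congr 1
    push_cast; ring

theorem finrank_ellipseLine {l : ℝ} (hl : 0 < l) (t : ℝ) :
    Module.finrank ℝ (ellipseLine l t) = 1 := by
  refine finrank_span_singleton fun h => ?_
  have h0 := congrArg (fun v : EuclideanSpace ℝ (Fin 2) => v 0) h
  have h1 := congrArg (fun v : EuclideanSpace ℝ (Fin 2) => v 1) h
  simp [hl.ne'] at h0 h1
  simpa [h0, h1] using sin_sq_add_cos_sq t

theorem exists_eq_ellipseLine {l : ℝ} (hl : 0 < l)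
    {V : Submodule ℝ (EuclideanSpace ℝ (Fin 2))} (hV : Module.finrank ℝ V = 1) :
    ∃ t, V = ellipseLine l t := by
  obtain ⟨v, hv0, hv⟩ := finrank_eq_one_iff'.1 hV
  have hVs : V = Submodule.span ℝ {(v : EuclideanSpace ℝ (Fin 2))} := by
    refine le_antisymm (fun w hw => ?_) ?_
    · obtain ⟨c, hc⟩ := hv ⟨w, hw⟩
      exact Submodule.mem_span_singleton.2 ⟨c, congrArg Subtype.val hc⟩
    · rw [Submodule.span_singleton_le_iff_mem]; exact v.2
  -- Undoing diag(1,l) turns the spanning vector into z, whose argument is the required parameter.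
  set z : ℂ := ⟨(v : EuclideanSpace ℝ (Fin 2)) 0, (v : EuclideanSpace ℝ (Fin 2)) 1 / l⟩ with hz
  have hz0 : z ≠ 0 := by
    intro h
    apply hv0
    have h0 := congrArg Complex.re h
    have h1 := congrArg Complex.im h
    simp [hz, hl.ne'] at h0 h1
    ext i
    fin_cases i
    · simpa using h0
    · simpa using h1
  refine ⟨Complex.arg z, ?_⟩
  have : (v : EuclideanSpace ℝ (Fin 2)) = ‖z‖ • !₂[cos z.arg, l * sin z.arg] := by
    have h0 := Complex.norm_mul_cos_arg z
    have h1 := Complex.norm_mul_sin_arg z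
    ext i
    fin_cases i
    · simp only [Fin.zero_eta, PiLp.smul_apply, smul_eq_mul]
      simp [hz]
    · simp only [Fin.mk_one, PiLp.smul_apply, smul_eq_mul]
      simp only [Matrix.cons_val_one, Matrix.cons_val_fin_one]
      rw [mul_left_comm, h1, hz]
      field_simp
  rw [hVs, this, Submodule.span_singleton_smul_eq (IsUnit.mk0 _ (norm_ne_zero_iff.2 hz0))]
  rfl

/-! ### The angle of one step and its symmetries -/

/-- The angle between the line through `(cos t, ρ sin t)` and its image under
`normalForm ρ φ`. -/
noncomputable def stepAngle (ρ φ t : ℝ) : ℝ :=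
  arccos |cos (psi ρ (t + φ) - psi ρ t)|

theorem sum_Icc_one_eq_sum_range (f : ℕ → ℝ) (n : ℕ) :
    ∑ j ∈ Finset.Icc 1 n, f j = ∑ j ∈ Finset.range n, f (j + 1) := by
  rw [Finset.range_eq_Ico, Finset.sum_Ico_add' f 0 n 1]
  rfl

theorem angleSum_ellipseLine {ρ : ℝ} (hρ : 0 < ρ) (φ t : ℝ) (n : ℕ) :
    angleSum (fun _ => normalForm ρ φ) n (ellipseLine ρ t) =
      ∑ j ∈ Finset.range n, stepAngle ρ φ (t + j * φ) := by
  rw [angleSum, sum_Icc_one_eq_sum_range]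
  refine Finset.sum_congr rfl fun j _ => ?_
  rw [Nat.add_sub_cancel, imageSubspace_solutionOp hρ, imageSubspace_solutionOp hρ,
    lineAngle_ellipseLine hρ, stepAngle]
  congr 4
  push_cast; ring_nf

theorem autonomousAngularValue_normalForm {ρ : ℝ} (hρ : 0 < ρ) (φ : ℝ) :
    autonomousAngularValue (normalForm ρ φ) =
      ⨆ t : ℝ, limsup (fun n : ℕ => (1 / (n : ℝ)) *
        ∑ j ∈ Finset.range n, stepAngle ρ φ (t + j * φ)) atTop := by
  simp only [← angleSum_ellipseLine hρ]
  let e : ℝ → {V : Submodule ℝ (EuclideanSpace ℝ (Fin 2)) // Module.finrank ℝ V = 1} :=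
    fun t => ⟨ellipseLine ρ t, finrank_ellipseLine hρ t⟩
  have he : Function.Surjective e := fun V => by
    obtain ⟨t, ht⟩ := exists_eq_ellipseLine hρ V.2
    exact ⟨t, Subtype.ext ht.symm⟩
  exact (he.iSup_comp (g := fun V : {V : Submodule ℝ (EuclideanSpace ℝ (Fin 2)) //
    Module.finrank ℝ V = 1} => limsup (fun n : ℕ => (1 / (n : ℝ)) *
      angleSum (fun _ => normalForm ρ φ) n V.1) atTop)).symm

theorem autonomousAngularValue_eq_of_tendsto {ρ φ : ℝ} (hρ : 0 < ρ) {L : ℝ → ℝ}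
    (h : ∀ t, Tendsto (fun n : ℕ => (1 / (n : ℝ)) *
      ∑ j ∈ Finset.range n, stepAngle ρ φ (t + j * φ)) atTop (𝓝 (L t))) :
    autonomousAngularValue (normalForm ρ φ) = ⨆ t, L t := by
  rw [autonomousAngularValue_normalForm hρ]
  exact iSup_congr fun t => (h t).limsup_eq

theorem stepAngle_pi_sub {ρ : ℝ} (hρ : 0 < ρ) (φ t : ℝ) :
    stepAngle ρ (π - φ) t = stepAngle ρ φ (-t) := by
  have h1 : t + (π - φ) = -(-t + φ) + π := by ring
  have h2 : t = -(-t) := by ring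
  rw [stepAngle, stepAngle, h1, psi_add_pi hρ, psi_neg hρ]
  conv_lhs => rw [h2, psi_neg hρ, neg_neg]
  rw [show -psi ρ (-t + φ) + π - -psi ρ (-t) = π - (psi ρ (-t + φ) - psi ρ (-t)) by ring,
    cos_pi_sub, abs_neg]

theorem stepAngle_add_pi {ρ : ℝ} (hρ : 0 < ρ) (φ t : ℝ) :
    stepAngle ρ φ (t + π) = stepAngle ρ φ t := by
  rw [stepAngle, stepAngle, add_right_comm, psi_add_pi hρ, psi_add_pi hρ, add_sub_add_right_eq_sub]

/-- Reflection in the first axis conjugates A(ρ,φ) to A(ρ,-φ) = -A(ρ,π-φ), and lines ignore the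
sign. On phases this is t ↦ -t, up to multiples of π. -/
theorem autonomousAngularValue_pi_sub {ρ : ℝ} (hρ : 0 < ρ) (φ : ℝ) :
    autonomousAngularValue (normalForm ρ (π - φ)) =
      autonomousAngularValue (normalForm ρ φ) := by
  rw [autonomousAngularValue_normalForm hρ, autonomousAngularValue_normalForm hρ]
  rw [← (Equiv.neg ℝ).iSup_comp]
  refine iSup_congr fun t => ?_
  congr 1
  funext n
  congr 1
  refine Finset.sum_congr rfl fun j _ => ?_
  have hper : Function.Periodic (stepAngle ρ φ) π := stepAngle_add_pi hρ φ
  rw [stepAngle_pi_sub hρ, ← hper.nat_mul j, Equiv.neg_apply]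
  congr 1
  ring

theorem continuous_stepAngle {ρ : ℝ} (hρ : 0 < ρ) (φ : ℝ) : Continuous (stepAngle ρ φ) := by
  have := continuous_psi hρ
  unfold stepAngle
  refine continuous_arccos.comp (continuous_abs.comp (continuous_cos.comp ?_))
  exact (this.comp (continuous_id.add continuous_const)).sub this

theorem arccos_abs_cos {d : ℝ} (hd : d ∈ Set.Icc 0 π) : arccos |cos d| = min d (π - d) := by
  rcases le_total d (π / 2) with h | h
  · rw [abs_of_nonneg (cos_nonneg_of_mem_Icc ⟨by linarith [hd.1, pi_pos], h⟩),
      arccos_cos hd.1 hd.2, min_eq_left (by linarith)]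
  · rw [abs_of_nonpos (cos_nonpos_of_pi_div_two_le_of_le h (by linarith [hd.2, pi_pos])),
      ← cos_pi_sub, arccos_cos (by linarith [hd.2]) (by linarith [hd.1]),
      min_eq_right (by linarith)]

theorem stepAngle_eq_min {ρ φ : ℝ} (hρ : 0 < ρ) (h0 : 0 < φ) (h1 : φ < π) (t : ℝ) :
    stepAngle ρ φ t = min (psi ρ (t + φ) - psi ρ t) (π - (psi ρ (t + φ) - psi ρ t)) :=
  arccos_abs_cos (Set.Ioo_subset_Icc_self (psi_sub_mem_Ioo hρ h0 h1 t))

/-- δ = π - 2d, so min(d, π - d) = d + min(δ, 0): negative δ marks the obtuse turns. -/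
theorem stepAngle_eq_add_min_deltaFun {ρ φ : ℝ} (hρ : 0 < ρ) (h0 : 0 < φ) (h1 : φ < π) (t : ℝ) :
    stepAngle ρ φ t = (psi ρ (t + φ) - psi ρ t) + min (deltaFun ρ φ t) 0 := by
  rw [stepAngle_eq_min hρ h0 h1, ← min_add_add_left, add_zero, min_comm, deltaFun]
  congr 1
  ring

theorem stepAngle_eq_sub {ρ φ : ℝ} (hρ : 0 < ρ) (h0 : 0 < φ) (h1 : φ < π) {t : ℝ}
    (h : 0 ≤ (1 + ρ ^ 2) * cos φ + (1 - ρ ^ 2) * cos (2 * t + φ)) :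
    stepAngle ρ φ t = psi ρ (t + φ) - psi ρ t := by
  have hd := psi_sub_mem_Ioo hρ h0 h1 t
  rw [stepAngle, abs_of_nonneg ((cos_psi_sub_nonneg_iff hρ φ t).2 h), arccos_cos hd.1.le hd.2.le]

theorem sum_psi_sub (ρ φ t : ℝ) (n : ℕ) :
    ∑ j ∈ Finset.range n, (psi ρ (t + j * φ + φ) - psi ρ (t + j * φ)) =
      psi ρ (t + n * φ) - psi ρ t := by
  have := Finset.sum_range_sub (fun j : ℕ => psi ρ (t + j * φ)) n
  simp only [Nat.cast_zero, zero_mul, add_zero] at this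
  rw [← this]
  refine Finset.sum_congr rfl fun j _ => ?_
  congr 2
  push_cast; ring

/-- The integrand is φ plus the difference between a π-periodic function and its translate, which
integrates to zero over a period. -/
theorem integral_psi_sub {ρ : ℝ} (hρ : 0 < ρ) (φ : ℝ) :
    ∫ t in 0..π, (psi ρ (t + φ) - psi ρ t) = π * φ := by
  have hc := continuous_psiOffset hρ
  have e : ∀ t, psi ρ (t + φ) - psi ρ t = φ + (psiOffset ρ (t + φ) - psiOffset ρ t) := fun t => by
    rw [psi_eq hρ, psi_eq hρ]; ring
  have hc' : Continuous fun t => psiOffset ρ (t + φ) := hc.comp (by fun_prop)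
  simp only [e]
  have hc'' : Continuous fun t => psiOffset ρ (t + φ) - psiOffset ρ t := hc'.sub hc
  rw [intervalIntegral.integral_add (by simp) (hc''.intervalIntegrable _ _),
    intervalIntegral.integral_sub (hc'.intervalIntegrable _ _) (hc.intervalIntegrable _ _),
    intervalIntegral.integral_comp_add_right (psiOffset ρ), zero_add, add_comm π φ,
    (psiOffset_periodic ρ).intervalIntegral_add_eq φ 0, zero_add, sub_self]
  simp

/-! ### Skewness at most one -/

theorem spectrum_normalForm {ρ : ℝ} (hρ : 0 < ρ) (φ : ℝ) (μ : ℂ) :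
    μ ∈ spectrum ℂ ((normalForm ρ φ).map (algebraMap ℝ ℂ)) ↔
      (μ - (Complex.cos φ + Complex.sin φ * Complex.I)) *
        (μ - (Complex.cos φ - Complex.sin φ * Complex.I)) = 0 := by
  rw [spectrum.mem_iff, Matrix.isUnit_iff_isUnit_det, isUnit_iff_ne_zero, not_not]
  have : (algebraMap ℂ (Matrix (Fin 2) (Fin 2) ℂ) μ -
      (normalForm ρ φ).map (algebraMap ℝ ℂ)).det =
      (μ - (Complex.cos φ + Complex.sin φ * Complex.I)) *
        (μ - (Complex.cos φ - Complex.sin φ * Complex.I)) := by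
    have hρ' : (ρ : ℂ) ≠ 0 := Complex.ofReal_ne_zero.2 hρ.ne'
    rw [Matrix.det_fin_two]
    simp [normalForm, Matrix.algebraMap_matrix_apply]
    field_simp
    linear_combination (Complex.sin φ) ^ 2 * Complex.I_sq
  rw [this]

theorem maxEigenvalueModulus_normalForm {ρ : ℝ} (hρ : 0 < ρ) (φ : ℝ) :
    maxEigenvalueModulus (normalForm ρ φ) = 1 := by
  have h1 : ‖Complex.cos φ + Complex.sin φ * Complex.I‖ = 1 := by
    rw [← Complex.exp_mul_I, Complex.norm_exp_ofReal_mul_I]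
  have h2 : ‖Complex.cos φ - Complex.sin φ * Complex.I‖ = 1 := by
    have := Complex.norm_exp_ofReal_mul_I (-φ)
    rw [Complex.exp_mul_I, Complex.ofReal_neg, Complex.cos_neg, Complex.sin_neg, neg_mul,
      ← sub_eq_add_neg] at this
    exact this
  have : {r : ℝ | ∃ μ ∈ spectrum ℂ ((normalForm ρ φ).map (algebraMap ℝ ℂ)), r = ‖μ‖} = {1} := by
    ext r
    constructor
    · rintro ⟨μ, hμ, rfl⟩
      rw [spectrum_normalForm hρ, mul_eq_zero, sub_eq_zero, sub_eq_zero] at hμ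
      rcases hμ with rfl | rfl
      · exact h1
      · exact h2
    · rintro rfl
      exact ⟨_, (spectrum_normalForm hρ φ _).2 (by rw [sub_self, zero_mul]), h1.symm⟩
  rw [maxEigenvalueModulus, this, csSup_singleton]

/-- The operator norm is tested on the first basis vector. This direction of the estimate turns skew
≤ 1 into an upper bound for sin φ. -/
theorem le_skewness_normalForm {ρ : ℝ} (hρ : 0 < ρ) (φ : ℝ) :
    (ρ + ρ⁻¹) * sin φ / 2 ≤ skewness (normalForm ρ φ) := by
  rw [skewness, maxEigenvalueModulus_normalForm hρ]
  have h := (Matrix.toEuclideanCLM (n := Fin 2) (𝕜 := ℝ)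
    (normalForm ρ φ - (normalForm ρ φ).transpose)).le_opNorm (EuclideanSpace.single 0 1)
  have e : Matrix.toEuclideanCLM (n := Fin 2) (𝕜 := ℝ)
      (normalForm ρ φ - (normalForm ρ φ).transpose) (EuclideanSpace.single 0 1) =
      EuclideanSpace.single 1 ((ρ + ρ⁻¹) * sin φ) := by
    ext i
    fin_cases i
    · simp [normalForm, Matrix.ofLp_toEuclideanCLM]
    · simp [normalForm, Matrix.ofLp_toEuclideanCLM]
      ring
  rw [e, PiLp.norm_single, PiLp.norm_single, norm_one, mul_one] at h
  have := (le_abs_self _).trans h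
  linarith

theorem cos_combination_nonneg_of_skewness_le_one {ρ φ : ℝ} (hρ0 : 0 < ρ) (hρ1 : ρ ≤ 1)
    (h0 : 0 < φ) (h1 : φ ≤ π / 2) (hs : skewness (normalForm ρ φ) ≤ 1) (x : ℝ) :
    0 ≤ (1 + ρ ^ 2) * cos φ + (1 - ρ ^ 2) * cos x := by
  have h := (le_skewness_normalForm hρ0 φ).trans hs
  have hc : 0 ≤ cos φ := cos_nonneg_of_mem_Icc ⟨by linarith [pi_pos], h1⟩
  have hsin : 0 ≤ sin φ := sin_nonneg_of_nonneg_of_le_pi h0.le (by linarith [pi_pos])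
  have h2 : (1 + ρ ^ 2) * sin φ ≤ 2 * ρ := by
    have e : (1 + ρ ^ 2) * sin φ = ((ρ + ρ⁻¹) * sin φ / 2) * (2 * ρ) := by field_simp; ring
    rw [e]; nlinarith
  -- Squaring and sin² + cos² = 1 reduce this to (1 + ρ²)² - 4ρ² = (1 - ρ²)².
  have h3 : 1 - ρ ^ 2 ≤ (1 + ρ ^ 2) * cos φ := by
    refine le_of_sq_le_sq ?_ (by positivity)
    have := pow_le_pow_left₀ (by positivity) h2 2
    nlinarith [sin_sq_add_cos_sq φ]
  have h4 : 0 ≤ 1 - ρ ^ 2 := by nlinarith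
  nlinarith [neg_one_le_cos x]

theorem autonomousAngularValue_of_skewness_le_one {ρ φ : ℝ} (hρ0 : 0 < ρ) (hρ1 : ρ ≤ 1)
    (h0 : 0 < φ) (h1 : φ ≤ π / 2) (hs : skewness (normalForm ρ φ) ≤ 1) :
    autonomousAngularValue (normalForm ρ φ) = φ := by
  rw [autonomousAngularValue_eq_of_tendsto hρ0 (L := fun _ => φ) fun t => ?_, ciSup_const]
  -- The telescoped sum is nφ plus a difference of two offsets, each at most π/2 in modulus.
  refine tendsto_average_of_bounded (C := π) fun n => ?_
  rw [Finset.sum_congr rfl fun j _ => stepAngle_eq_sub hρ0 h0 (by linarith [pi_pos])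
    (cos_combination_nonneg_of_skewness_le_one hρ0 hρ1 h0 h1 hs _), sum_psi_sub,
    psi_eq hρ0, psi_eq hρ0]
  have a := abs_le.1 (abs_psiOffset_le ρ t)
  have b := abs_le.1 (abs_psiOffset_le ρ (t + n * φ))
  rw [abs_le]
  constructor <;> linarith

/-! ### Irrational φ/π -/

theorem continuous_deltaFun {ρ : ℝ} (hρ : 0 < ρ) (φ : ℝ) : Continuous (deltaFun ρ φ) := by
  have hc := continuous_psi hρ
  have hc' : Continuous fun t => psi ρ (t + φ) := hc.comp (by fun_prop)
  exact ((continuous_const.mul hc).sub (continuous_const.mul hc')).add continuous_const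

theorem integrableOn_deltaFun {ρ : ℝ} (hρ : 0 < ρ) (φ : ℝ) :
    IntegrableOn (deltaFun ρ φ) {t | t ∈ Set.Icc 0 π ∧ deltaFun ρ φ t < 0} volume :=
  ((continuous_deltaFun hρ φ).integrableOn_Icc (a := 0) (b := π)).mono_set fun _ h => h.1

theorem integral_min_deltaFun {ρ : ℝ} (hρ : 0 < ρ) (φ : ℝ) :
    ∫ t in 0..π, min (deltaFun ρ φ t) 0 =
      ∫ t in {t | t ∈ Set.Icc 0 π ∧ deltaFun ρ φ t < 0}, deltaFun ρ φ t := by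
  have hm : MeasurableSet {t | deltaFun ρ φ t < 0} :=
    (isOpen_lt (continuous_deltaFun hρ φ) continuous_const).measurableSet
  have e : (fun t => min (deltaFun ρ φ t) 0) =
      Set.indicator {t | deltaFun ρ φ t < 0} (deltaFun ρ φ) := by
    funext t
    by_cases h : deltaFun ρ φ t < 0
    · rw [Set.indicator_of_mem (by exact h), min_eq_left h.le]
    · rw [Set.indicator_of_notMem (by exact h), min_eq_right (not_lt.1 h)]
  rw [intervalIntegral.integral_of_le pi_pos.le, ← integral_Icc_eq_integral_Ioc, e,
    setIntegral_indicator hm]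
  rfl

theorem autonomousAngularValue_of_irrational {ρ φ : ℝ} (hρ : 0 < ρ) (h0 : 0 < φ) (h1 : φ < π)
    (hφ : Irrational (φ / π)) :
    autonomousAngularValue (normalForm ρ φ) =
      φ + (1 / π) * ∫ t in {t | t ∈ Set.Icc 0 π ∧ deltaFun ρ φ t < 0}, deltaFun ρ φ t := by
  have hc := continuous_psi hρ
  have hc' : Continuous fun t => psi ρ (t + φ) := hc.comp (by fun_prop)
  have hc2 : Continuous fun t => psi ρ (t + φ) - psi ρ t := hc'.sub hc
  have hc3 : Continuous fun t => min (deltaFun ρ φ t) 0 :=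
    (continuous_deltaFun hρ φ).min continuous_const
  rw [autonomousAngularValue_eq_of_tendsto hρ fun t => tendsto_average_of_irrational pi_pos hφ
    (continuous_stepAngle hρ φ) (stepAngle_add_pi hρ φ) t, ciSup_const]
  simp only [stepAngle_eq_add_min_deltaFun hρ h0 h1]
  rw [intervalIntegral.integral_add (hc2.intervalIntegrable _ _) (hc3.intervalIntegrable _ _),
    integral_psi_sub hρ, integral_min_deltaFun hρ]
  field_simp

/-! ### Rational φ/π -/

/-- The sum of the angles along `q` steps of the orbit of the line through
`(cos t, ρ sin t)`. -/
noncomputable def orbitAngleSum (ρ φ : ℝ) (q : ℕ) (t : ℝ) : ℝ :=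
  ∑ j ∈ Finset.range q, stepAngle ρ φ (t + j * φ)

theorem autonomousAngularValue_of_rational {ρ φ : ℝ} (hρ : 0 < ρ) {p q : ℕ} (hq : 0 < q)
    (hφ : q * φ = p * π) :
    autonomousAngularValue (normalForm ρ φ) = ⨆ t, (1 / (q : ℝ)) * orbitAngleSum ρ φ q t := by
  refine autonomousAngularValue_eq_of_tendsto hρ fun t => tendsto_average_of_periodic hq fun j => ?_
  have hper : Function.Periodic (stepAngle ρ φ) π := stepAngle_add_pi hρ φ
  refine Eq.trans ?_ (hper.nat_mul p (t + j * φ))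
  rw [← hφ]
  congr 1
  push_cast; ring

theorem orbitAngleSum_periodic {ρ : ℝ} (hρ : 0 < ρ) (φ : ℝ) (q : ℕ) :
    Function.Periodic (orbitAngleSum ρ φ q) π := fun t =>
  Finset.sum_congr rfl fun j _ => by rw [add_right_comm, stepAngle_add_pi hρ]

/-- The step from -t to -t + φ is the mirror image of the step from t - φ to t, traversed backwards.
-/
theorem stepAngle_neg {ρ : ℝ} (hρ : 0 < ρ) (φ t : ℝ) :
    stepAngle ρ φ (-t) = stepAngle ρ φ (t - φ) := by
  rw [stepAngle, stepAngle, sub_add_cancel, show -t + φ = -(t - φ) by ring, psi_neg hρ, psi_neg hρ]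
  congr 3
  ring

theorem orbitAngleSum_neg {ρ φ : ℝ} (hρ : 0 < ρ) {p q : ℕ} (hφ : q * φ = p * π) (t : ℝ) :
    orbitAngleSum ρ φ q (-t) = orbitAngleSum ρ φ q t := by
  have hper : Function.Periodic (stepAngle ρ φ) π := stepAngle_add_pi hρ φ
  rw [orbitAngleSum, orbitAngleSum, ← Finset.sum_range_reflect]
  refine Finset.sum_congr rfl fun j hj => ?_
  have hj' : j + 1 ≤ q := Finset.mem_range.1 hj
  rw [show -t + ((q - 1 - j : ℕ) : ℝ) * φ = -(t - ((q - 1 - j : ℕ) : ℝ) * φ) by ring,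
    -- Reversing the summation makes the phase t - (q - j)φ; adding pπ = qφ turns it into t + jφ.
    stepAngle_neg hρ, ← hper.nat_mul p, ← hφ, Nat.sub_sub, add_comm 1 j, Nat.cast_sub hj']
  congr 1
  push_cast; ring

theorem continuous_orbitAngleSum {ρ : ℝ} (hρ : 0 < ρ) (φ : ℝ) (q : ℕ) :
    Continuous (orbitAngleSum ρ φ q) :=
  continuous_finsetSum _ fun _ _ => (continuous_stepAngle hρ φ).comp (by fun_prop)

theorem range_orbitAngleSum {ρ φ : ℝ} (hρ : 0 < ρ) {p q : ℕ} (hφ : q * φ = p * π) :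
    Set.range (orbitAngleSum ρ φ q) = orbitAngleSum ρ φ q '' Set.Icc 0 (π / 2) := by
  refine Set.Subset.antisymm ?_ (Set.image_subset_range _ _)
  rintro _ ⟨t, rfl⟩
  have hb : |t - round (t / π) * π| ≤ π / 2 := by
    have h := abs_sub_round (t / π)
    have h2 : t - round (t / π) * π = (t / π - round (t / π)) * π := by
      field_simp
    rw [h2, abs_mul, abs_of_pos pi_pos]
    nlinarith [pi_pos]
  refine ⟨_, ⟨abs_nonneg _, hb⟩, ?_⟩
  rw [← (orbitAngleSum_periodic hρ φ q).sub_int_mul_eq (round (t / π)) (x := t)]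
  rcases abs_choice (t - round (t / π) * π) with h | h <;> rw [h]
  exact orbitAngleSum_neg hρ hφ _

/-- The angle θ enters through the phase Ψ_{1/ρ}(θ), from which θ_j is the polar angle after j
steps. -/
theorem sum_gFun {ρ φ : ℝ} (hρ : 0 < ρ) (h0 : 0 < φ) (h1 : φ < π) (q : ℕ) (t : ℝ) :
    ∑ j ∈ Finset.Icc 1 q, gFun ρ φ j t = orbitAngleSum ρ φ q (psi ρ⁻¹ t) := by
  rw [sum_Icc_one_eq_sum_range, orbitAngleSum]
  refine Finset.sum_congr rfl fun j _ => ?_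
  rw [stepAngle_eq_min hρ h0 h1, gFun, thetaIter, thetaIter, Nat.add_sub_cancel,
    show ((j + 1 : ℕ) : ℝ) * φ + psi ρ⁻¹ t = psi ρ⁻¹ t + j * φ + φ by push_cast; ring,
    add_comm ((j : ℝ) * φ)]
  congr 1
  ring

theorem exists_isGreatest_sum_gFun {ρ φ : ℝ} (hρ : 0 < ρ) (h0 : 0 < φ) (h1 : φ < π) {p q : ℕ}
    (hq : 0 < q) (hφ : q * φ = p * π) :
    ∃ M : ℝ, IsGreatest ((fun t : ℝ => ∑ j ∈ Finset.Icc 1 q, gFun ρ φ j t) '' Set.Icc 0 (π / 2)) M ∧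
      autonomousAngularValue (normalForm ρ φ) = (1 / (q : ℝ)) * M := by
  have e : (fun t : ℝ => ∑ j ∈ Finset.Icc 1 q, gFun ρ φ j t) '' Set.Icc 0 (π / 2) =
      Set.range (orbitAngleSum ρ φ q) := by
    rw [range_orbitAngleSum hρ hφ]
    conv_rhs => rw [← psi_image_Icc (inv_pos.2 hρ), Set.image_image]
    exact Set.image_congr fun t _ => sum_gFun hρ h0 h1 q t
  rw [e]
  obtain ⟨M, hM⟩ : ∃ M, IsGreatest (Set.range (orbitAngleSum ρ φ q)) M := by
    rw [range_orbitAngleSum hρ hφ]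
    exact (isCompact_Icc.image (continuous_orbitAngleSum hρ φ q)).exists_isGreatest
      ((Set.nonempty_Icc.2 (by positivity)).image _)
  refine ⟨M, hM, ?_⟩
  rw [autonomousAngularValue_of_rational hρ hq hφ, ← Real.mul_iSup_of_nonneg (by positivity)]
  congr 1
  exact hM.csSup_eq

/-- Over q steps the differences d add up to π, which bounds every orbit sum. Phase π/2 attains the
bound because each of its steps has d ≤ π/2. -/
theorem autonomousAngularValue_pi_div {ρ φ : ℝ} (hρ0 : 0 < ρ) (hρ1 : ρ ≤ 1) {q : ℕ} (hq : 2 ≤ q)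
    (hφ : q * φ = π) : autonomousAngularValue (normalForm ρ φ) = φ := by
  have hq' : (2 : ℝ) ≤ q := by exact_mod_cast hq
  have h0 : 0 < φ := by
    by_contra! h
    nlinarith [pi_pos]
  have h1 : φ < π := by nlinarith
  have hφ1 : q * φ = (1 : ℕ) * π := by simpa using hφ
  have hcos : 0 ≤ cos φ := cos_nonneg_of_mem_Icc ⟨by linarith, by nlinarith⟩
  have hsum : ∀ t, ∑ j ∈ Finset.range q, (psi ρ (t + j * φ + φ) - psi ρ (t + j * φ)) = π := by
    intro t
    rw [sum_psi_sub, hφ, psi_add_pi hρ0]; ring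
  have hM : IsGreatest (Set.range (orbitAngleSum ρ φ q)) π := by
    constructor
    · refine ⟨π / 2, ?_⟩
      refine Eq.trans ?_ (hsum (π / 2))
      refine Finset.sum_congr rfl fun j hj => stepAngle_eq_sub hρ0 h0 h1 ?_
      have hj : (j : ℝ) + 1 ≤ q := by exact_mod_cast Finset.mem_range.1 hj
      have hj0 : (0 : ℝ) ≤ j := j.cast_nonneg
      have e : cos (2 * (π / 2 + j * φ) + φ) = -cos ((2 * j + 1) * φ) := by
        rw [show 2 * (π / 2 + j * φ) + φ = (2 * j + 1) * φ + π by ring, cos_add_pi]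
      -- Since j < q and qφ = π, the angle (2j+1)φ lies in [φ, 2π - φ]. The criterion for an acute
      -- step is then bounded below by 2ρ² cos φ ≥ 0.
      have hle : cos ((2 * j + 1) * φ) ≤ cos φ := by
        rcases le_total ((2 * j + 1) * φ) π with h | h
        · exact cos_le_cos_of_nonneg_of_le_pi h0.le h (by nlinarith)
        · rw [← cos_two_pi_sub]
          exact cos_le_cos_of_nonneg_of_le_pi h0.le (by linarith) (by nlinarith)
      rw [e]
      nlinarith [mul_nonneg (by nlinarith : 0 ≤ 1 - ρ ^ 2) (sub_nonneg.2 hle),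
        mul_nonneg (sq_nonneg ρ) hcos]
    · rintro _ ⟨t, rfl⟩
      refine le_of_le_of_eq ?_ (hsum t)
      refine Finset.sum_le_sum fun j _ => ?_
      rw [stepAngle_eq_min hρ0 h0 h1]
      exact min_le_left _ _
  rw [autonomousAngularValue_of_rational hρ0 (by omega) hφ1,
    ← Real.mul_iSup_of_nonneg (by positivity), iSup, hM.csSup_eq, ← hφ]
  field_simp

/-! ### The theorem -/

theorem theorem6p1 (ρ φ : ℝ) (hρ0 : 0 < ρ) (hρ1 : ρ ≤ 1) :
    (0 < φ → φ ≤ π / 2 →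
      (skewness (normalForm ρ φ) ≤ 1 → autonomousAngularValue (normalForm ρ φ) = φ) ∧
      (1 < skewness (normalForm ρ φ) → Irrational (φ / π) →
        IntegrableOn (deltaFun ρ φ) {t | t ∈ Set.Icc 0 π ∧ deltaFun ρ φ t < 0} volume ∧
        autonomousAngularValue (normalForm ρ φ) =
          φ + (1 / π) * ∫ t in {t | t ∈ Set.Icc 0 π ∧ deltaFun ρ φ t < 0}, deltaFun ρ φ t) ∧
      (1 < skewness (normalForm ρ φ) → ∀ q : ℕ, 2 ≤ q → φ / π = 1 / (q : ℝ) →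
        autonomousAngularValue (normalForm ρ φ) = φ) ∧
      (1 < skewness (normalForm ρ φ) → ∀ p q : ℕ, 0 < p → 0 < q → ¬ p ∣ q →
        φ / π = (p : ℝ) / (q : ℝ) →
        ∃ M : ℝ,
          IsGreatest ((fun t : ℝ => ∑ j ∈ Finset.Icc 1 q, gFun ρ φ j t) '' Set.Icc 0 (π / 2)) M ∧
          autonomousAngularValue (normalForm ρ φ) = (1 / (q : ℝ)) * M)) ∧
    (π / 2 < φ → φ < π →
      autonomousAngularValue (normalForm ρ φ) =
        autonomousAngularValue (normalForm ρ (π - φ))) := by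
  refine ⟨fun h0 h1 => ?_, fun _ _ => (autonomousAngularValue_pi_sub hρ0 φ).symm⟩
  have hφπ : φ < π := by linarith [pi_pos]
  refine ⟨autonomousAngularValue_of_skewness_le_one hρ0 hρ1 h0 h1, fun _ hφ => ?_,
    fun _ q hq hφ => ?_, fun _ p q _ hq _ hφ => ?_⟩
  · exact ⟨integrableOn_deltaFun hρ0 φ, autonomousAngularValue_of_irrational hρ0 h0 hφπ hφ⟩
  · refine autonomousAngularValue_pi_div hρ0 hρ1 hq ?_
    have hq' : (q : ℝ) ≠ 0 := Nat.cast_ne_zero.2 (by omega)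
    field_simp at hφ
    linarith
  · refine exists_isGreatest_sum_gFun hρ0 h0 hφπ (p := p) hq ?_
    have hq' : (q : ℝ) ≠ 0 := Nat.cast_ne_zero.2 hq.ne'
    field_simp at hφ
    linarith
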